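/- \textbf{Theorem (lower bound on cofinal amalgamation in a finite language).} There are a finite relational language $L$ (all relation symbols of positive arity), a computable $L$-structure $M$ with underlying set contained in $\omega$, and a canonical computable age $\mathbf K$ of $M$ such that $\mathbf K$ has the cofinal amalgamation property (coAP), but whenever $\mathbf s$ is a Turing degree for which $\mathbf K$ has an $\mathbf s$-computable witness to coAP, then $\mathbf 0' \le_{\mathrm T} \mathbf s$. Here the following terminology is used. \emph{Computable ages.} A computable age is a sequence $(\mathbf a_i, A_i)_{i\in\omega}$ where $\mathbf a_i$ is a finite tuple of natural numbers, computable from $i$, and $A_i$ is an $L$-structure with underlying set contained in $\omega$, computable uniformly in $i$ and generated by $\mathbf a_i$. It represents the age consisting of all structures isomorphic to some $A_i$. It is a canonical computable age of $M$ if $(\mathbf a_i)_{i\in\omega}$ is a computable enumeration of all finite tuples in $M$ in which each tuple occurs infinitely often, and $A_i$ is the substructure of $M$ generated by $\mathbf a_i$. \emph{Cofinal amalgamation.} A member $A'$ of an age $\mathcal K$ is an amalgamation base if for all $B, C\in\mathcal K$ and embeddings $f\colon A'\to B$, $g\colon A'\to C$ there are $D\in\mathcal K$ and embeddings $f'\colon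 B\to D$, $g'\colon C\to D$ with $f'\circ f=g'\circ g$. The age $\mathcal K$ has coAP if each of its members embeds into an amalgamation base; a computable age has coAP if the age that it represents does. \emph{Potential embeddings.} A potential embedding in $\mathbf K$ is a triple $F=(i,j,\mathbf c)$ with $\mathbf c$ a finite tuple in $A_j$; put $\mathrm{dom}(F)=i$, $\mathrm{codom}(F)=j$, $\mathrm{range}(F)=\mathbf c$. It is an embedding (respectively an isomorphism) if $\mathbf a_i\mapsto\mathbf c$ extends to an embedding (respectively an isomorphism) $A_i\to A_j$. If $\mathrm{codom}(F)=\mathrm{dom}(G)$, then $G\circ F$ is $(\mathrm{dom}(F),\mathrm{codom}(G),\mathbf d)$, where $\mathbf d$ is the image of $\mathrm{range}(F)$ under the map induced by $G$ if $G$ is an embedding, and $\mathbf d=\mathrm{range}(G)$ otherwise. A potential span is a pair $(F_0,F_1)$ of potential embeddings with $\mathrm{dom}(F_0)=\mathrm{dom}(F_1)$; it is a span if both are embeddings. An amalgamation diagram over a potential span $(F_0,F_1)$ is a pair $(G_0,G_1)$ with $G_0$ an embedding, $G_1$ a potential embedding, $\mathrm{dom}(G_i)=\mathrm{codom}(F_i)$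 for $i=0,1$, $\mathrm{codom}(G_0)=\mathrm{codom}(G_1)$, and such that, if $(F_0,F_1)$ is a span, then $G_1$ is an embedding and $G_0\circ F_0=G_1\circ F_1$. \emph{Witnesses.} A witness to coAP for $\mathbf K$ is a pair $(W,\Phi)$ such that \begin{itemize} \item $W$ is a set of embeddings in $\mathbf K$, closed under composition on either side with isomorphisms in $\mathbf K$, such that every $i\in\omega$ is the domain of some $F\in W$, and such that $A_{\mathrm{codom}(F)}$ is an amalgamation base of the age represented by $\mathbf K$ for every $F\in W$; \item $\Phi$ is a function which takes the triples $(F,G_0,G_1)$ with $F\in W$ and $(G_0,G_1)$ a potential span such that $\mathrm{dom}(G_0)=\mathrm{dom}(G_1)=\mathrm{codom}(F)$, and returns an amalgamation diagram over $(G_0,G_1)$. \end{itemize} It is $\mathbf s$-computable if $W$ is $\mathbf s$-c.e. and $\Phi$ is an $\mathbf s$-computable partial function. -/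

import Mathlib

open FirstOrder FirstOrder.Language

namespace CompAge

/-! ### Oracle computability -/

/-- The characteristic function of a set of natural numbers, as an oracle. -/
noncomputable def charFun (S : Set ℕ) : ℕ →. ℕ := by
  classical exact fun n => Part.some (if n ∈ S then 1 else 0)

/-- Turing reducibility between sets of natural numbers (the Turing degrees are the degrees of
such sets). -/
def SetTuringLE (A S : Set ℕ) : Prop := TuringReducible (charFun A) (charFun S)

/-- A partial function is `S`-computable. -/
def PartialComputableFrom {α β : Type} [Primcodable α] [Primcodable β] (S : Set ℕ)
    (f : α →. β) : Prop :=
  RecursiveIn {charFun S} f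

/-- A set is `S`-c.e.: it is the domain of an `S`-computable partial function. -/
def EnumerableFrom {α : Type} [Primcodable α] (S : Set ℕ) (W : Set α) : Prop :=
  PartialComputableFrom S fun a => Part.assert (a ∈ W) fun _ => Part.some ()

/-- The jump `0'` of the least Turing degree: the set of all `e` such that the `e`-th program
halts on input `e`. -/
def zeroJump : Set ℕ := {e | (Nat.Partrec.Code.eval (Denumerable.ofNat Nat.Partrec.Code e) e).Dom}

/-! ### Computable representations of languages and structures -/

/-- A computable representation of a language: the symbols are coded by natural numbers, the sets
of codes of relation symbols and of function symbols are computable and disjoint, and the arity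
can be computed from the code. -/
structure LanguageRep (L : FirstOrder.Language.{0, 0}) where
  relCode : (Σ n, L.Relations n) → ℕ
  funCode : (Σ n, L.Functions n) → ℕ
  relCode_injective : Function.Injective relCode
  funCode_injective : Function.Injective funCode
  disjoint_codes : Disjoint (Set.range relCode) (Set.range funCode)
  computable_rel : ComputablePred fun n => n ∈ Set.range relCode
  computable_fun : ComputablePred fun n => n ∈ Set.range funCode
  computable_arity : ∃ ar : ℕ → ℕ, Computable ar ∧
    (∀ R, ar (relCode R) = R.1) ∧ (∀ f, ar (funCode f) = f.1)

/-- An `L`-structure whose underlying set is a set of natural numbers. -/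
structure NatStructure (L : FirstOrder.Language.{0, 0}) where
  carrier : Set ℕ
  str : L.Structure carrier

attribute [instance] NatStructure.str

variable {L : FirstOrder.Language.{0, 0}}

/-- `n` codes a relation symbol which holds of the tuple `a` in `A`. -/
def RelHolds (ρ : LanguageRep L) (A : NatStructure L) (n : ℕ) (a : List ℕ) : Prop :=
  ∃ (R : Σ k, L.Relations k) (x : Fin R.1 → A.carrier),
    ρ.relCode R = n ∧ List.ofFn (fun i => (x i : ℕ)) = a ∧ Structure.RelMap R.2 x

/-- `n` codes a relation symbol which fails of the tuple `a` in `A`. -/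
def RelFails (ρ : LanguageRep L) (A : NatStructure L) (n : ℕ) (a : List ℕ) : Prop :=
  ∃ (R : Σ k, L.Relations k) (x : Fin R.1 → A.carrier),
    ρ.relCode R = n ∧ List.ofFn (fun i => (x i : ℕ)) = a ∧ ¬ Structure.RelMap R.2 x

/-- `n` codes a function symbol whose value on the tuple `a` in `A` is `b`. -/
def FunGraph (ρ : LanguageRep L) (A : NatStructure L) (n : ℕ) (a : List ℕ) (b : ℕ) : Prop :=
  ∃ (f : Σ k, L.Functions k) (x : Fin f.1 → A.carrier),
    ρ.funCode f = n ∧ List.ofFn (fun i => (x i : ℕ)) = a ∧ ((Structure.funMap f.2 x : A.carrier) : ℕ) = b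

/-- A sequence of structures is uniformly computable: the underlying sets are uniformly computable,
and the positive and negative facts about relations and the graphs of functions are
uniformly c.e. -/
structure UniformlyComputable (ρ : LanguageRep L) (A : ℕ → NatStructure L) : Prop where
  carrier : ComputablePred fun p : ℕ × ℕ => p.2 ∈ (A p.1).carrier
  rel_pos : REPred fun p : ℕ × ℕ × List ℕ => RelHolds ρ (A p.1) p.2.1 p.2.2
  rel_neg : REPred fun p : ℕ × ℕ × List ℕ => RelFails ρ (A p.1) p.2.1 p.2.2
  fun_graph : REPred fun p : ℕ × ℕ × List ℕ × ℕ => FunGraph ρ (A p.1) p.2.1 p.2.2.1 p.2.2.2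

/-- A computable structure. -/
structure IsComputableStructure (ρ : LanguageRep L) (M : NatStructure L) : Prop where
  carrier : ComputablePred fun x : ℕ => x ∈ M.carrier
  rel_pos : REPred fun p : ℕ × List ℕ => RelHolds ρ M p.1 p.2
  rel_neg : REPred fun p : ℕ × List ℕ => RelFails ρ M p.1 p.2
  fun_graph : REPred fun p : ℕ × List ℕ × ℕ => FunGraph ρ M p.1 p.2.1 p.2.2

/-! ### Ages as classes of structures -/

/-- `A` is an amalgamation base of the class `𝒦`: any two extensions of `A` in `𝒦` can be
amalgamated over `A` in `𝒦`. -/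
def IsAmalgamationBase (𝒦 : Set (CategoryTheory.Bundled.{0} L.Structure))
    (A : CategoryTheory.Bundled.{0} L.Structure) : Prop :=
  A ∈ 𝒦 ∧ ∀ (B C : CategoryTheory.Bundled.{0} L.Structure) (f : A ↪[L] B) (g : A ↪[L] C),
    B ∈ 𝒦 → C ∈ 𝒦 → ∃ (D : CategoryTheory.Bundled.{0} L.Structure) (f' : B ↪[L] D)
      (g' : C ↪[L] D), D ∈ 𝒦 ∧ f'.comp f = g'.comp g

/-- The cofinal amalgamation property of a class of structures. -/
def CofinalAmalgamation (𝒦 : Set (CategoryTheory.Bundled.{0} L.Structure)) : Prop :=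
  ∀ A ∈ 𝒦, ∃ A' : CategoryTheory.Bundled.{0} L.Structure,
    Nonempty (A ↪[L] A') ∧ IsAmalgamationBase 𝒦 A'

/-! ### Computable ages -/

/-- A computable age: a computable sequence of pairs `(tuple i, struct i)`, where `struct i` is a
computable structure (uniformly in `i`) generated by the finite tuple `tuple i`. -/
structure ComputableAge (ρ : LanguageRep L) where
  tuple : ℕ → List ℕ
  struct : ℕ → NatStructure L
  tuple_mem : ∀ i, ∀ x ∈ tuple i, x ∈ (struct i).carrier
  generates : ∀ i,
    Substructure.closure L {x : (struct i).carrier | (x : ℕ) ∈ tuple i} = ⊤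
  computable_tuple : Computable tuple
  computable_struct : UniformlyComputable ρ struct

/-- A triple `(i, j, c)`, to be read as the assignment from the distinguished generators of the
`i`-th structure of an age to the tuple `c` in the `j`-th structure. -/
abbrev AgeMap : Type := ℕ × ℕ × List ℕ

/-- The index of the domain. -/
abbrev AgeMap.dom (F : AgeMap) : ℕ := F.1
/-- The index of the codomain. -/
abbrev AgeMap.cod (F : AgeMap) : ℕ := F.2.1
/-- The tuple in the codomain. -/
abbrev AgeMap.range (F : AgeMap) : List ℕ := F.2.2

open Classical in
/-- An embedding of structures on sets of natural numbers, as a function on natural numbers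
(the values off the underlying set of the domain are irrelevant). -/
noncomputable def applyTo {A B : NatStructure L} (f : A.carrier ↪[L] B.carrier) (x : ℕ) : ℕ :=
  if hx : x ∈ A.carrier then (f ⟨x, hx⟩ : B.carrier) else x

namespace ComputableAge

variable {ρ : LanguageRep L} (K : ComputableAge ρ)

/-- The `i`-th structure of a computable age. -/
def bundled (i : ℕ) : CategoryTheory.Bundled.{0} L.Structure :=
  ⟨(K.struct i).carrier, (K.struct i).str⟩

/-- The age represented by `K`: all structures isomorphic to some `struct i`. -/
def age : Set (CategoryTheory.Bundled.{0} L.Structure) :=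
  {A | ∃ i, Nonempty (A ≃[L] K.bundled i)}

/-- `K` is a canonical computable age of `M`: the tuples of `K` are the finite tuples in `M`, each
of them listed infinitely often, and the `i`-th structure is the substructure of `M` generated by
the `i`-th tuple. -/
structure IsCanonicalAgeOf (M : NatStructure L) : Prop where
  tuple_mem : ∀ i, ∀ x ∈ K.tuple i, x ∈ M.carrier
  infinitely_often : ∀ a : List ℕ, (∀ x ∈ a, x ∈ M.carrier) → {i | K.tuple i = a}.Infinite
  struct_eq : ∀ i, ∃ ι : (K.struct i).carrier ↪[L] M.carrier, (∀ x, (ι x : ℕ) = x) ∧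
    ι.toHom.range = Substructure.closure L {x : M.carrier | (x : ℕ) ∈ K.tuple i}

/-- Potential embeddings: the tuple lies in the codomain. -/
def IsPotentialEmbedding (F : AgeMap) : Prop :=
  ∀ x ∈ F.range, x ∈ (K.struct F.cod).carrier

/-- The embedding `f` of structures takes the generators of the domain of `F` to the tuple of `F`.
(There is at most one such `f`.) -/
def Represents (F : AgeMap) (f : (K.struct F.dom).carrier ↪[L] (K.struct F.cod).carrier) : Prop :=
  (K.tuple F.dom).pmap (fun x hx => (f ⟨x, hx⟩ : ℕ)) (K.tuple_mem F.dom) = F.range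

/-- `F` is an embedding: the assignment of the generators extends to an embedding of structures
(equivalently, the generators and the tuple of `F` satisfy the same atomic formulas). -/
def IsEmbedding (F : AgeMap) : Prop := ∃ f, K.Represents F f

/-- `F` is an isomorphism of structures. -/
def IsIsomorphism (F : AgeMap) : Prop :=
  ∃ f : (K.struct F.dom).carrier ≃[L] (K.struct F.cod).carrier, K.Represents F f.toEmbedding

open Classical in
/-- The composition `G ∘ F`, meant for `F.cod = G.dom`. If `G` is an embedding, apply the
embedding of structures it induces to the tuple of `F`; otherwise take the tuple of `G`. -/
noncomputable def comp (G F : AgeMap) : AgeMap :=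
  (F.dom, G.cod,
    if h : ∃ g, K.Represents G g then F.range.map (applyTo h.choose) else G.range)

/-- Potential spans. -/
def IsPotentialSpan (F₀ F₁ : AgeMap) : Prop :=
  K.IsPotentialEmbedding F₀ ∧ K.IsPotentialEmbedding F₁ ∧ F₀.dom = F₁.dom

/-- Spans. -/
def IsSpan (F₀ F₁ : AgeMap) : Prop :=
  K.IsPotentialSpan F₀ F₁ ∧ K.IsEmbedding F₀ ∧ K.IsEmbedding F₁

/-- `(G₀, G₁)` is an amalgamation diagram over the potential span `(F₀, F₁)`. -/
structure IsAmalgamationDiagram (F₀ F₁ G₀ G₁ : AgeMap) : Prop where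
  embedding₀ : K.IsEmbedding G₀
  potential₁ : K.IsPotentialEmbedding G₁
  dom₀ : G₀.dom = F₀.cod
  dom₁ : G₁.dom = F₁.cod
  cod : G₀.cod = G₁.cod
  of_span : K.IsSpan F₀ F₁ → K.IsEmbedding G₁ ∧ K.comp G₀ F₀ = K.comp G₁ F₁

/-- A collection of distinguished extensions. -/
structure IsDistinguishedExtensions (W : Set AgeMap) : Prop where
  embedding : ∀ F ∈ W, K.IsEmbedding F
  precomp : ∀ F ∈ W, ∀ G, K.IsIsomorphism G → G.cod = F.dom → K.comp F G ∈ W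
  postcomp : ∀ F ∈ W, ∀ H, K.IsIsomorphism H → H.dom = F.cod → K.comp H F ∈ W
  exists_dom : ∀ i, ∃ F ∈ W, F.dom = i

/-- `(W, Φ)` is a witness to the cofinal amalgamation property: `W` is a collection of
distinguished extensions whose codomains are amalgamation bases, and the partial function `Φ`,
defined exactly on the triples `(F, G₀, G₁)` with `F ∈ W` and `(G₀, G₁)` a potential span over the
codomain of `F`, gives an amalgamation diagram over `(G₀, G₁)`. -/
structure IsWitness (W : Set AgeMap) (Φ : AgeMap × AgeMap × AgeMap →. AgeMap × AgeMap) : Prop where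
  distinguished : K.IsDistinguishedExtensions W
  base : ∀ F ∈ W, IsAmalgamationBase K.age (K.bundled F.cod)
  dom_iff : ∀ F G₀ G₁, (Φ (F, G₀, G₁)).Dom ↔
    F ∈ W ∧ K.IsPotentialSpan G₀ G₁ ∧ G₀.dom = F.cod ∧ G₁.dom = F.cod
  diagram : ∀ F G₀ G₁ H₀ H₁, (H₀, H₁) ∈ Φ (F, G₀, G₁) → K.IsAmalgamationDiagram G₀ G₁ H₀ H₁

/-- The witness `(W, Φ)` is `S`-computable. -/
def IsComputableWitness (S : Set ℕ) (W : Set AgeMap)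
    (Φ : AgeMap × AgeMap × AgeMap →. AgeMap × AgeMap) : Prop :=
  K.IsWitness W Φ ∧ EnumerableFrom S W ∧ PartialComputableFrom S Φ

/-- The `S`-computable cofinal amalgamation property: there is an `S`-computable witness. -/
def HasComputableCoAP (S : Set ℕ) : Prop := ∃ W Φ, K.IsComputableWitness S W Φ

end ComputableAge

end CompAge

namespace CompAge

/-! ### Approximating oracle computations by computations with finite oracles -/

/-! The structure is a disjoint union of finite paths whose first and last points are marked, so
that an embedding must carry a full path onto a full path of the same length. For every `e` there
are infinitely many uncoloured paths of length `e`. If `e` lies in `0'`, there are also infinitely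
many paths of length `e` followed by one further point, in each of two colours. Colour 1 is marked
by a relation and colour 2 by its absence. Numbering the coloured copies by bounds on the halting
time keeps the structure computable.

An uncoloured path of length `e` with `e` in `0'` can be given either colour, and the two extensions
cannot be amalgamated: the successor of the end of the path is unique and cannot have both colours.
Hence no amalgamation base contains the end of such a path (`not_isAmalgamationBase`). Conversely,
finite unions of components that are coloured or have length outside `0'` are amalgamation bases
(`isAmalgamationBase_pointsIn`): any embedding of such a union is undone by a self-embedding of the
whole structure, which pulls any two extensions into a common position. Every finite structure in
the age embeds into such a union, because uncoloured paths with length in `0'` can be coloured. This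
gives coAP.

Now let `W` belong to a witness. Some `F` in `W` starts at the uncoloured path of length `e` and
ends in an amalgamation base. The component containing the image is coloured if and only if `e` lies
in `0'` (`colour_ne_zero_iff`), and the colour can be read off from the code of a point. Searching
the `S`-c.e. set `W` for such an `F` therefore decides `0'` (`setTuringLE_of_search`). To run this
search, oracle computations are replaced by ordinary computations on initial segments of the oracle
(`exists_approximates`), whose stages can be dovetailed. -/

/-- The increasing sequence of partial functions `F` converges to `f`. -/
structure Approximates (F : ℕ → ℕ → Part ℕ) (f : ℕ → Part ℕ) : Prop where
  mono : ∀ {m n x y}, m ≤ n → y ∈ F m x → y ∈ F n x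
  mem_iff : ∀ {x y}, y ∈ f x ↔ ∃ n, y ∈ F n x

namespace Approximates

variable {F G : ℕ → ℕ → Part ℕ} {f g : ℕ → Part ℕ}

theorem const (f : ℕ → Part ℕ) : Approximates (fun _ => f) f :=
  ⟨fun _ h => h, by simp⟩

/-- Each of the two values appears at some stage, and by monotonicity both are present at the larger
one. -/
theorem pair (hF : Approximates F f) (hG : Approximates G g) :
    Approximates (fun k n => Nat.pair <$> F k n <*> G k n)
      (fun n => Nat.pair <$> f n <*> g n) := by
  have key : ∀ (p q : Part ℕ) (y : ℕ), y ∈ (Nat.pair <$> p <*> q) ↔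
      ∃ a ∈ p, ∃ b ∈ q, Nat.pair a b = y := by
    intro p q y
    simp [Seq.seq]
  constructor
  · intro m n x y hmn
    rw [key, key]
    rintro ⟨a, ha, b, hb, h⟩
    exact ⟨a, hF.mono hmn ha, b, hG.mono hmn hb, h⟩
  · intro x y
    rw [key]
    simp only [key]
    constructor
    · rintro ⟨a, ha, b, hb, h⟩
      obtain ⟨i, hi⟩ := hF.mem_iff.1 ha
      obtain ⟨j, hj⟩ := hG.mem_iff.1 hb
      exact ⟨max i j, a, hF.mono (le_max_left _ _) hi, b, hG.mono (le_max_right _ _) hj, h⟩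
    · rintro ⟨n, a, ha, b, hb, h⟩
      exact ⟨a, hF.mem_iff.2 ⟨n, ha⟩, b, hG.mem_iff.2 ⟨n, hb⟩, h⟩

theorem comp (hF : Approximates F f) (hG : Approximates G g) :
    Approximates (fun k n => (G k n).bind (F k)) (fun n => (g n).bind f) := by
  constructor
  · intro m n x y hmn
    simp only [Part.mem_bind_iff]
    rintro ⟨a, ha, h⟩
    exact ⟨a, hG.mono hmn ha, hF.mono hmn h⟩
  · intro x y
    simp only [Part.mem_bind_iff]
    constructor
    · rintro ⟨a, ha, h⟩
      obtain ⟨i, hi⟩ := hG.mem_iff.1 ha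
      obtain ⟨j, hj⟩ := hF.mem_iff.1 h
      exact ⟨max i j, a, hG.mono (le_max_left _ _) hi, hF.mono (le_max_right _ _) hj⟩
    · rintro ⟨n, a, ha, h⟩
      exact ⟨a, hG.mem_iff.2 ⟨n, ha⟩, hF.mem_iff.2 ⟨n, h⟩⟩

theorem prec (hF : Approximates F f) (hG : Approximates G g) :
    Approximates
      (fun k p => Nat.rec (F k p.unpair.1) (fun y IH =>
        IH.bind fun i => G k (Nat.pair p.unpair.1 (Nat.pair y i))) p.unpair.2)
      (fun p => Nat.rec (f p.unpair.1) (fun y IH =>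
        IH.bind fun i => g (Nat.pair p.unpair.1 (Nat.pair y i))) p.unpair.2) := by
  constructor
  · intro m n x y hmn
    induction x.unpair.2 generalizing y with
    | zero => exact hF.mono hmn
    | succ t ih =>
      simp only [Part.mem_bind_iff]
      rintro ⟨a, ha, h⟩
      exact ⟨a, ih ha, hG.mono hmn h⟩
  · intro x y
    -- Monotonicity is needed for every number `t` of recursion steps, to bring the earlier value
    -- and the last step to a common stage.
    have mono : ∀ (t : ℕ) {m n y}, m ≤ n →
        y ∈ (Nat.rec (F m x.unpair.1) (fun y IH =>
          IH.bind fun i => G m (Nat.pair x.unpair.1 (Nat.pair y i))) t : Part ℕ) →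
        y ∈ (Nat.rec (F n x.unpair.1) (fun y IH =>
          IH.bind fun i => G n (Nat.pair x.unpair.1 (Nat.pair y i))) t : Part ℕ) := by
      intro t m n y hmn
      induction t generalizing y with
      | zero => exact hF.mono hmn
      | succ t ih =>
        simp only [Part.mem_bind_iff]
        rintro ⟨a, ha, h⟩
        exact ⟨a, ih ha, hG.mono hmn h⟩
    induction x.unpair.2 generalizing y with
    | zero => exact hF.mem_iff
    | succ t ih =>
      simp only [Part.mem_bind_iff]
      constructor
      · rintro ⟨a, ha, h⟩
        obtain ⟨i, hi⟩ := ih.1 ha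
        obtain ⟨j, hj⟩ := hG.mem_iff.1 h
        exact ⟨max i j, a, mono t (le_max_left _ _) hi, hG.mono (le_max_right _ _) hj⟩
      · rintro ⟨n, a, ha, h⟩
        exact ⟨a, ih.2 ⟨n, ha⟩, hG.mem_iff.2 ⟨n, h⟩⟩

/-- A successful search inspects only finitely many values, so one stage serves for all of them. -/
theorem rfind (hF : Approximates F f) :
    Approximates
      (fun k a => Nat.rfind fun n => (F k (Nat.pair a n)).map fun m => decide (m = 0))
      (fun a => Nat.rfind fun n => (f (Nat.pair a n)).map fun m => decide (m = 0)) := by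
  have key : ∀ (p : ℕ → Part ℕ) (y : ℕ),
      y ∈ Nat.rfind (fun n => (p n).map fun m => decide (m = 0)) ↔
        (∃ a ∈ p y, decide (a = 0) = true) ∧
          ∀ j < y, ∃ a ∈ p j, decide (a = 0) = false := by
    intro p y
    refine Nat.mem_rfind.trans (and_congr (Part.mem_map_iff _) ?_)
    exact forall₂_congr fun j _ => Part.mem_map_iff _
  constructor
  · intro m n x y hmn h
    obtain ⟨⟨a, ha, h⟩, h'⟩ := (key _ _).1 h
    refine (key _ _).2 ⟨⟨a, hF.mono hmn ha, h⟩, fun j hj => ?_⟩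
    obtain ⟨b, hb, hb'⟩ := h' j hj
    exact ⟨b, hF.mono hmn hb, hb'⟩
  · intro x y
    constructor
    · intro h
      obtain ⟨⟨a, ha, h⟩, h'⟩ := (key _ _).1 h
      obtain ⟨i, hi⟩ := hF.mem_iff.1 ha
      have : ∀ j, ∃ k, j < y → ∃ b ∈ F k (Nat.pair x j), decide (b = 0) = false := by
        intro j
        by_cases hj : j < y
        · obtain ⟨b, hb, hb'⟩ := h' j hj
          obtain ⟨k, hk⟩ := hF.mem_iff.1 hb
          exact ⟨k, fun _ => ⟨b, hk, hb'⟩⟩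
        · exact ⟨0, fun h => absurd h hj⟩
      choose k hk using this
      refine ⟨max i ((Finset.range y).sup k), (key _ _).2
        ⟨⟨a, hF.mono (le_max_left _ _) hi, h⟩, fun j hj => ?_⟩⟩
      obtain ⟨b, hb, hb'⟩ := hk j hj
      exact ⟨b, hF.mono ((Finset.le_sup (Finset.mem_range.2 hj)).trans (le_max_right _ _)) hb, hb'⟩
    · rintro ⟨n, h⟩
      obtain ⟨⟨a, ha, h⟩, h'⟩ := (key _ _).1 h
      refine (key _ _).2 ⟨⟨a, hF.mem_iff.2 ⟨n, ha⟩, h⟩, fun j hj => ?_⟩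
      obtain ⟨b, hb, hb'⟩ := h' j hj
      exact ⟨b, hF.mem_iff.2 ⟨n, hb⟩, hb'⟩

end Approximates

/-! ### Initial segments of a total oracle -/

/-- The first `n` values of `h`. -/
def initialSegment (h : ℕ → ℕ) (n : ℕ) : List ℕ := (List.range n).map h

/-- A total function as an oracle. -/
def totalOracle (h : ℕ → ℕ) : ℕ →. ℕ := fun n => Part.some (h n)

theorem approximates_oracle (h : ℕ → ℕ) :
    Approximates (fun n x => ((initialSegment h n)[x]? : Part ℕ)) fun n => Part.some (h n) := by
  have key : ∀ n x y, y ∈ (((initialSegment h n)[x]? : Option ℕ) : Part ℕ) ↔ x < n ∧ y = h x := by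
    intro n x y
    simp only [Part.mem_coe, initialSegment, List.getElem?_map, Option.mem_def,
      Option.map_eq_some_iff, List.getElem?_eq_some_iff, List.length_range, List.getElem_range]
    grind
  constructor
  · intro m n x y hmn
    rw [key, key]
    exact fun h => ⟨h.1.trans_le hmn, h.2⟩
  · intro x y
    simp only [key]
    simp only [Part.mem_some_iff]
    exact ⟨fun h => ⟨x + 1, by omega, h⟩, fun ⟨_, _, h⟩ => h⟩

/-- A function computable from `h` is the limit of computations using initial segments of `h`. -/
theorem exists_approximates {h : ℕ → ℕ} {f : ℕ →. ℕ}
    (hf : Nat.RecursiveIn {totalOracle h} f) :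
    ∃ F : List ℕ → ℕ → Part ℕ, Partrec₂ F ∧ Approximates (fun n => F (initialSegment h n)) f := by
  have base : ∀ {g : ℕ →. ℕ}, Nat.Partrec g →
      ∃ F : List ℕ → ℕ → Part ℕ, Partrec₂ F ∧ Approximates (fun n => F (initialSegment h n)) g :=
    fun {g} hg => ⟨fun _ => g, (Partrec.nat_iff.2 hg).comp Computable.snd, Approximates.const g⟩
  induction hf with
  | zero => exact base .zero
  | succ => exact base .succ
  | left => exact base .left
  | right => exact base .right
  | oracle g hg =>
    obtain rfl := hg
    -- Queries beyond the length of `σ` diverge, so a longer segment can only add answers.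
    refine ⟨fun σ x => (σ[x]? : Option ℕ), ?_, approximates_oracle h⟩
    exact Computable.ofOption (Primrec.list_getElem?.to_comp.comp Computable.fst Computable.snd)
  | pair _ _ ihf ihg =>
    obtain ⟨F, hF, hF'⟩ := ihf
    obtain ⟨G, hG, hG'⟩ := ihg
    refine ⟨fun σ n => Nat.pair <$> F σ n <*> G σ n, ?_, hF'.pair hG'⟩
    have : Partrec fun p : List ℕ × ℕ =>
        (F p.1 p.2).bind fun a => (G p.1 p.2).map fun b => Nat.pair a b :=
      Partrec.bind hF (Partrec.map (hG.comp (Computable.fst.comp Computable.fst)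
        (Computable.snd.comp Computable.fst)) (Primrec₂.natPair.to_comp.comp
          (Computable.snd.comp Computable.fst) Computable.snd))
    refine this.of_eq fun p => ?_
    simp [Seq.seq]
  | comp _ _ ihf ihg =>
    obtain ⟨F, hF, hF'⟩ := ihf
    obtain ⟨G, hG, hG'⟩ := ihg
    refine ⟨fun σ n => (G σ n).bind (F σ), ?_, hF'.comp hG'⟩
    exact Partrec.bind hG (hF.comp (Computable.fst.comp Computable.fst) Computable.snd)
  | prec _ _ ihf ihg =>
    obtain ⟨F, hF, hF'⟩ := ihf
    obtain ⟨G, hG, hG'⟩ := ihg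
    refine ⟨fun σ p => Nat.rec (F σ p.unpair.1) (fun y IH =>
      IH.bind fun i => G σ (Nat.pair p.unpair.1 (Nat.pair y i))) p.unpair.2, ?_, hF'.prec hG'⟩
    have hu : Computable fun p : List ℕ × ℕ => p.2.unpair :=
      Computable.unpair.comp Computable.snd
    refine Partrec.nat_rec (f := fun p : List ℕ × ℕ => p.2.unpair.2) (Computable.snd.comp hu)
      (hF.comp Computable.fst (Computable.fst.comp hu))
      (h := fun p (q : ℕ × ℕ) => G p.1 (Nat.pair p.2.unpair.1 (Nat.pair q.1 q.2))) ?_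
    exact hG.comp (Computable.fst.comp Computable.fst) (Primrec₂.natPair.to_comp.comp
      (Computable.fst.comp (hu.comp Computable.fst)) (Primrec₂.natPair.to_comp.comp
        (Computable.fst.comp Computable.snd) (Computable.snd.comp Computable.snd)))
  | rfind _ ihf =>
    obtain ⟨F, hF, hF'⟩ := ihf
    refine ⟨fun σ a => Nat.rfind fun n => (F σ (Nat.pair a n)).map fun m => decide (m = 0),
      ?_, hF'.rfind⟩
    refine Partrec.rfind (p := fun (p : List ℕ × ℕ) n =>
      (F p.1 (Nat.pair p.2 n)).map fun m => decide (m = 0)) ?_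
    refine Partrec.map (hF.comp (Computable.fst.comp Computable.fst) (Primrec₂.natPair.to_comp.comp
      (Computable.snd.comp Computable.fst) Computable.snd)) ?_
    exact (PrimrecRel.comp Primrec.eq Primrec.snd (Primrec.const 0)).decide.to_comp

/-- The code of the list is built by primitive recursion on its length, with one oracle query per
step; the recursion parameter is a dummy `0`. -/
theorem recursiveIn_initialSegment (h : ℕ → ℕ) :
    Nat.RecursiveIn {totalOracle h} fun n => Part.some (Encodable.encode (initialSegment h n)) := by
  have step : Nat.RecursiveIn {totalOracle h} fun p : ℕ =>
      (Nat.pair <$> (Part.some p.unpair.2.unpair.2) <*>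
        ((Part.some p.unpair.2.unpair.1).bind (totalOracle h))) := by
    refine .pair ?_ (.comp (.oracle _ rfl) ?_)
    · exact Nat.Primrec.recursiveIn
        (Primrec.nat_iff.1 (Primrec.snd.comp (Primrec.unpair.comp (Primrec.snd.comp Primrec.unpair))))
    · exact Nat.Primrec.recursiveIn
        (Primrec.nat_iff.1 (Primrec.fst.comp (Primrec.unpair.comp (Primrec.snd.comp Primrec.unpair))))
  let app : ℕ → ℕ := fun q =>
    Encodable.encode (Denumerable.ofNat (List ℕ) q.unpair.1 ++ [q.unpair.2])
  have happ : Nat.Primrec app := Primrec.nat_iff.1 <| Primrec.encode.comp <|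
    Primrec.list_concat.comp ((Primrec.ofNat _).comp (Primrec.fst.comp Primrec.unpair))
      (Primrec.snd.comp Primrec.unpair)
  have := (Nat.RecursiveIn.prec (Nat.Primrec.recursiveIn (Nat.Primrec.const (Encodable.encode ([] : List ℕ))))
    ((Nat.Primrec.recursiveIn happ).comp step)).comp
      (Nat.Primrec.recursiveIn (Primrec.nat_iff.1 (Primrec₂.natPair.comp (Primrec.const 0) Primrec.id)))
  refine this.of_eq fun n => ?_
  change (Part.some (Nat.pair 0 n)).bind _ = Part.some (Encodable.encode (initialSegment h n))
  rw [Part.bind_some, Nat.unpair_pair]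
  induction n with
  | zero => rfl
  | succ n ih =>
    refine (congrArg (fun p : Part ℕ => p.bind _) ih).trans ?_
    rw [Part.bind_some]
    change (Nat.pair <$> Part.some
      (Nat.pair 0 (Nat.pair n (Encodable.encode (initialSegment h n)))).unpair.2.unpair.2 <*>
      (Part.some (Nat.pair 0 (Nat.pair n
        (Encodable.encode (initialSegment h n)))).unpair.2.unpair.1).bind fun n => Part.some (h n)).bind
      (fun q => Part.some (app q)) = _
    simp only [Nat.unpair_pair]
    simp [Seq.seq, app, initialSegment, List.range_succ]

/-! ### Searching an `S`-c.e. set -/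

/-- The characteristic function of a set, as a total function. -/
noncomputable def charFn (S : Set ℕ) : ℕ → ℕ := by
  classical exact fun n => if n ∈ S then 1 else 0

theorem charFun_eq (S : Set ℕ) : charFun S = totalOracle (charFn S) := rfl

/-- Unbounded search with an oracle. -/
theorem recursiveIn_of_search {h : ℕ → ℕ} {T : List ℕ → ℕ → ℕ → Bool} {out : ℕ → ℕ}
    (hT : Computable fun p : List ℕ × ℕ × ℕ => T p.1 p.2.1 p.2.2) (ho : Computable out)
    {f : ℕ → ℕ} (hex : ∀ e, ∃ m, T (initialSegment h m) e m = true)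
    (hout : ∀ e m, T (initialSegment h m) e m = true → out m = f e) :
    Nat.RecursiveIn {totalOracle h} (totalOracle f) := by
  -- The test is inverted because `Nat.rfind` looks for the value `0`.
  let t : ℕ → ℕ := fun q =>
    if T (Denumerable.ofNat (List ℕ) q.unpair.1) q.unpair.2.unpair.1 q.unpair.2.unpair.2
    then 0 else 1
  have ht : Computable t := by
    have h1 : Computable fun q : ℕ => (Denumerable.ofNat (List ℕ) q.unpair.1, q.unpair.2.unpair) :=
      (((Primrec.ofNat _).comp (Primrec.fst.comp Primrec.unpair)).pair
        (Primrec.unpair.comp (Primrec.snd.comp Primrec.unpair))).to_comp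
    exact (Computable.cond (hT.comp h1) (Computable.const 0) (Computable.const 1)).of_eq
      fun q => by simp [t, Bool.cond_eq_ite]
  have ht' : Nat.RecursiveIn {totalOracle h} (totalOracle t) :=
    Nat.Partrec.recursiveIn (Partrec.nat_iff.1 ht)
  have hs : Nat.RecursiveIn {totalOracle h} fun p : ℕ =>
      (Nat.pair <$> (Part.some p.unpair.2 >>= fun n =>
        Part.some (Encodable.encode (initialSegment h n))) <*> Part.some p) :=
    .pair (.comp (recursiveIn_initialSegment h) .right)
      (Nat.Primrec.recursiveIn Nat.Primrec.id)
  have key := (Nat.Partrec.recursiveIn (O := {totalOracle h}) (Partrec.nat_iff.1 ho)).comp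
    (Nat.RecursiveIn.rfind (ht'.comp hs))
  refine key.of_eq fun e => ?_
  have hsimp : ∀ m, ((Nat.pair <$> ((Part.some (Nat.pair e m).unpair.2).bind fun n =>
        Part.some (Encodable.encode (initialSegment h n))) <*> Part.some (Nat.pair e m)).bind
          fun q => Part.some (t q)).map (fun m => decide (m = 0)) =
      Part.some (T (initialSegment h m) e m) := by
    intro m
    simp [Seq.seq, t]
  change (Nat.rfind fun m => ((Nat.pair <$> ((Part.some (Nat.pair e m).unpair.2).bind fun n =>
        Part.some (Encodable.encode (initialSegment h n))) <*> Part.some (Nat.pair e m)).bind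
          fun q => Part.some (t q)).map (fun m => decide (m = 0))).bind
            (fun m => Part.some (out m)) = Part.some (f e)
  simp only [hsimp]
  have hd : (Nat.rfind fun m => Part.some (T (initialSegment h m) e m)).Dom := by
    obtain ⟨m, hm⟩ := hex e
    exact Nat.rfind_dom.2 ⟨m, by simp [hm], fun {_} _ => trivial⟩
  refine Part.eq_some_iff.2 (Part.mem_bind_iff.2 ⟨_, Part.get_mem hd, ?_⟩)
  have := (Nat.mem_rfind.1 (Part.get_mem hd)).1
  rw [Part.mem_some_iff] at this
  simp [hout e _ this.symm]

/-- A set is computable from `S` if its elements can be decided by looking at an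
arbitrary element, with suitable properties, of an `S`-c.e. set. -/
theorem setTuringLE_of_search {α : Type} [Primcodable α] {A S : Set ℕ} {W : Set α}
    (hW : EnumerableFrom S W) {r : ℕ → α → Bool} {q : α → Bool}
    (hr : Computable₂ r) (hq : Computable q)
    (hex : ∀ e, ∃ w ∈ W, r e w = true)
    (hdec : ∀ e, ∀ w ∈ W, r e w = true → (q w = true ↔ e ∈ A)) :
    SetTuringLE A S := by
  have hW' : Nat.RecursiveIn {totalOracle (charFn S)} _ := hW
  obtain ⟨F, hF, hFa⟩ := exists_approximates hW'
  obtain ⟨c, hc⟩ := Nat.Partrec.Code.exists_code.1 hF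
  have hmem : ∀ w : α, w ∈ W ↔ ∃ n, (F (initialSegment (charFn S) n) (Encodable.encode w)).Dom := by
    intro w
    constructor
    · intro hw
      have : Encodable.encode () ∈ (Part.bind (Encodable.decode (α := α) (Encodable.encode w))
          fun a => (Part.assert (a ∈ W) fun _ => Part.some ()).map Encodable.encode) := by
        simp only [Encodable.encodek]
        simp [Part.assert_pos hw]
      obtain ⟨n, hn⟩ := hFa.mem_iff.1 this
      exact ⟨n, Part.dom_iff_mem.2 ⟨_, hn⟩⟩
    · rintro ⟨n, hn⟩
      have := hFa.mem_iff.2 ⟨n, Part.get_mem hn⟩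
      simp at this
      exact this.1
  -- Bounding the running time by `k` makes convergence with the finite oracle `σ` decidable.
  let step : List ℕ → ℕ → ℕ → Bool := fun σ k w =>
    (Nat.Partrec.Code.evaln k c (Encodable.encode (σ, w))).isSome
  have hstep : Primrec fun p : List ℕ × ℕ × ℕ => step p.1 p.2.1 p.2.2 :=
    Primrec.option_isSome.comp <| Nat.Partrec.Code.primrec_evaln.comp <|
      ((Primrec.fst.comp Primrec.snd).pair (Primrec.const c)).pair
        (Primrec.encode.comp (Primrec.fst.pair (Primrec.snd.comp Primrec.snd)))
  have hdom : ∀ σ w, (F σ w).Dom ↔ ∃ k, step σ k w = true := by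
    intro σ w
    have : (Nat.Partrec.Code.eval c (Encodable.encode (σ, w))).Dom ↔ (F σ w).Dom := by
      rw [hc]; simp [Part.bind, Part.assert]
    rw [← this, Part.dom_iff_mem]
    simp only [Nat.Partrec.Code.evaln_complete, step, Option.isSome_iff_exists, Option.mem_def]
    exact exists_comm
  have hstep_mono : ∀ {σ k l w}, k ≤ l → step σ k w = true → step σ l w = true := by
    intro σ k l w hkl
    simp only [step, Option.isSome_iff_exists]
    rintro ⟨a, ha⟩
    exact ⟨a, Nat.Partrec.Code.evaln_mono hkl ha⟩
  -- The number `m` codes a candidate `w`, an oracle length `n` and a time bound `k`. Since `n ≤ m`,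
  -- the first `m` oracle values suffice, and they are cut down to `n`.
  let T : List ℕ → ℕ → ℕ → Bool := fun σ e m =>
    ((Encodable.decode (α := α) m.unpair.1).map fun w =>
      (step (σ.take m.unpair.2.unpair.1) m.unpair.2.unpair.2 (Encodable.encode w) && r e w)).getD
      false
  let out : ℕ → ℕ := fun m =>
    ((Encodable.decode (α := α) m.unpair.1).map fun w => cond (q w) 1 0).getD 0
  have hu1 : Primrec fun m : ℕ => m.unpair.1 := Primrec.fst.comp Primrec.unpair
  have hu2 : Primrec fun m : ℕ => m.unpair.2.unpair := Primrec.unpair.comp (Primrec.snd.comp Primrec.unpair)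
  have hT : Computable fun p : List ℕ × ℕ × ℕ => T p.1 p.2.1 p.2.2 := by
    have hm : Primrec fun p : List ℕ × ℕ × ℕ => p.2.2 := Primrec.snd.comp Primrec.snd
    have h1 : Primrec fun p : (List ℕ × ℕ × ℕ) × α =>
        (p.1.1.take p.1.2.2.unpair.2.unpair.1, p.1.2.2.unpair.2.unpair.2, Encodable.encode p.2) :=
      (Primrec.list_take.comp (Primrec.fst.comp (hu2.comp (hm.comp Primrec.fst)))
        (Primrec.fst.comp Primrec.fst)).pair
        ((Primrec.snd.comp (hu2.comp (hm.comp Primrec.fst))).pair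
          (Primrec.encode.comp Primrec.snd))
    have h2 : Computable₂ fun (p : List ℕ × ℕ × ℕ) (w : α) =>
        step (p.1.take p.2.2.unpair.2.unpair.1) p.2.2.unpair.2.unpair.2 (Encodable.encode w) &&
          r p.2.1 w :=
      Primrec.and.to_comp.comp (hstep.comp h1).to_comp
        (hr.comp (Computable.fst.comp (Computable.snd.comp Computable.fst)) Computable.snd)
    exact Computable.option_getD (Computable.option_map
      (Computable.decode.comp (hu1.comp hm).to_comp) h2) (Computable.const false)
  have hout : Computable out :=
    Computable.option_getD (Computable.option_map (Computable.decode.comp hu1.to_comp)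
      (Computable.cond (hq.comp Computable.snd) (Computable.const 1) (Computable.const 0)))
      (Computable.const 0)
  have htake : ∀ {k m}, k ≤ m →
      (initialSegment (charFn S) m).take k = initialSegment (charFn S) k := by
    intro k m hkm
    simp [initialSegment, ← List.map_take, List.take_range, hkm]
  unfold SetTuringLE TuringReducible
  rw [charFun_eq, charFun_eq, RecursiveIn.iff_nat]
  refine recursiveIn_of_search hT hout ?_ ?_
  · intro e
    obtain ⟨w, hw, hrw⟩ := hex e
    obtain ⟨n, hn⟩ := (hmem w).1 hw
    obtain ⟨k, hk⟩ := (hdom _ _).1 hn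
    refine ⟨Nat.pair (Encodable.encode w) (Nat.pair n k), ?_⟩
    have : n ≤ Nat.pair (Encodable.encode w) (Nat.pair n k) :=
      (Nat.left_le_pair _ _).trans (Nat.right_le_pair _ _)
    simp [T, htake this, hk, hrw]
  · intro e m hm
    simp only [T] at hm
    cases hd : Encodable.decode (α := α) m.unpair.1 with
    | none => simp [hd] at hm
    | some w =>
      simp only [hd, Option.map_some, Option.getD_some, Bool.and_eq_true] at hm
      have hle : m.unpair.2.unpair.1 ≤ m := (Nat.unpair_left_le _).trans (Nat.unpair_right_le _)
      rw [htake hle] at hm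
      have hw : w ∈ W := (hmem w).2 ⟨_, (hdom _ _).2 ⟨_, hm.1⟩⟩
      have := hdec e w hw hm.2
      simp only [out, hd, Option.map_some, Option.getD_some, charFn]
      by_cases he : e ∈ A
      · simp [he, this.2 he]
      · simp only [he, iff_false, Bool.not_eq_true] at this
        simp [he, this]

/-! ### The points of the structure

A point codes a pair of a component and a position in it. A component is a triple consisting of a
length `e`, a colour in `{0, 1, 2}`, and the number of a copy. Its points form a path
`0, …, e`; in a coloured component a coloured point `e + 1` follows. There are coloured components
of length `e` only if `e ∈ 0'`, and then their copies are numbered by bounds on the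
halting time. -/

/-- The point at position `k` in the component `C`. -/
def point (C : ℕ × ℕ × ℕ) (k : ℕ) : ℕ := Encodable.encode (C, k)

/-- The component of a point. -/
def component (x : ℕ) : ℕ × ℕ × ℕ := (Denumerable.ofNat ((ℕ × ℕ × ℕ) × ℕ) x).1

/-- The position of a point in its component. -/
def position (x : ℕ) : ℕ := (Denumerable.ofNat ((ℕ × ℕ × ℕ) × ℕ) x).2

@[simp] theorem component_point (C : ℕ × ℕ × ℕ) (k : ℕ) : component (point C k) = C := by
  simp only [component, point, Denumerable.ofNat_encode]

@[simp] theorem position_point (C : ℕ × ℕ × ℕ) (k : ℕ) : position (point C k) = k := by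
  simp only [position, point, Denumerable.ofNat_encode]

@[simp] theorem point_component_position (x : ℕ) : point (component x) (position x) = x := by
  simp only [component, position, point, Prod.mk.eta, Denumerable.encode_ofNat]

theorem point_ext {x y : ℕ} (h : component x = component y) (h' : position x = position y) :
    x = y := by
  rw [← point_component_position x, h, h', point_component_position]

/-- The program `e` halts on input `e` within `n` steps. -/
def HaltsWithin (e n : ℕ) : Prop :=
  (Nat.Partrec.Code.evaln n (Denumerable.ofNat Nat.Partrec.Code e) e).isSome = true

theorem HaltsWithin.mono {e m n : ℕ} (hmn : m ≤ n) (h : HaltsWithin e m) : HaltsWithin e n := by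
  obtain ⟨a, ha⟩ := Option.isSome_iff_exists.1 h
  exact Option.isSome_iff_exists.2 ⟨a, Nat.Partrec.Code.evaln_mono hmn ha⟩

theorem mem_zeroJump_iff {e : ℕ} : e ∈ zeroJump ↔ ∃ n, HaltsWithin e n := by
  simp only [zeroJump, Set.mem_ofPred_eq, Part.dom_iff_mem, Nat.Partrec.Code.evaln_complete,
    HaltsWithin, Option.isSome_iff_exists, Option.mem_def]
  exact exists_comm

/-- The components that occur in the structure. -/
def IsValid (C : ℕ × ℕ × ℕ) : Prop :=
  C.2.1 = 0 ∨ (C.2.1 ≤ 2 ∧ HaltsWithin C.1 C.2.2)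

theorem IsValid.mem_zeroJump {C : ℕ × ℕ × ℕ} (hC : IsValid C) (h : C.2.1 ≠ 0) :
    C.1 ∈ zeroJump :=
  mem_zeroJump_iff.2 ⟨_, (hC.resolve_left h).2⟩

/-- Copies can be renumbered upwards freely. This provides the room for the injective maps on
components below. -/
theorem IsValid.mono {e c m n : ℕ} (hmn : m ≤ n) (h : IsValid (e, c, m)) : IsValid (e, c, n) :=
  h.imp id fun h => ⟨h.1, h.2.mono hmn⟩

/-- The set of points of the structure. -/
def points : Set ℕ :=
  {x | IsValid (component x) ∧
    (position x ≤ (component x).1 ∨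
      position x = (component x).1 + 1 ∧ (component x).2.1 ≠ 0)}

/-- The relations: successor in a path, first point of a path, last point of a path, and
one of the two colours. -/
def Related (r x y : ℕ) : Prop :=
  (r = 0 ∧ component x = component y ∧ position y = position x + 1) ∨
  (r = 1 ∧ position x = 0) ∨
  (r = 2 ∧ position x = (component x).1) ∨
  (r = 3 ∧ position x = (component x).1 + 1 ∧ (component x).2.1 = 1)

theorem related_zero {x y : ℕ} :
    Related 0 x y ↔ component x = component y ∧ position y = position x + 1 := by
  simp [Related]

theorem related_one {x y : ℕ} : Related 1 x y ↔ position x = 0 := by simp [Related]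

theorem related_two {x y : ℕ} : Related 2 x y ↔ position x = (component x).1 := by
  simp [Related]

theorem related_three {x y : ℕ} :
    Related 3 x y ↔ position x = (component x).1 + 1 ∧ (component x).2.1 = 1 := by
  simp [Related]

theorem primrec_component : Primrec component := Primrec.fst.comp (Primrec.ofNat _)

theorem primrec_position : Primrec position := Primrec.snd.comp (Primrec.ofNat _)

theorem primrec_point : Primrec₂ point := Primrec.encode

theorem primrecPred_haltsWithin : PrimrecPred fun p : ℕ × ℕ => HaltsWithin p.1 p.2 := by
  refine PrimrecRel.comp (R := fun a b : Bool => a = b) Primrec.eq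
    (Primrec.option_isSome.comp (Nat.Partrec.Code.primrec_evaln.comp
      ((Primrec.snd.pair ((Primrec.ofNat _).comp Primrec.fst)).pair Primrec.fst)))
    (Primrec.const true)

theorem primrecPred_mem_points : PrimrecPred fun x => x ∈ points := by
  have he : Primrec fun x => (component x).1 := Primrec.fst.comp primrec_component
  have hs : Primrec fun x => (component x).2 := Primrec.snd.comp primrec_component
  have hc : Primrec fun x => (component x).2.1 := Primrec.fst.comp hs
  have hn : Primrec fun x => (component x).2.2 := Primrec.snd.comp hs
  have h0 : PrimrecPred fun x => (component x).2.1 = 0 := Primrec.eq.comp hc (Primrec.const 0)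
  exact (h0.or ((Primrec.nat_le.comp hc (Primrec.const 2)).and
    (primrecPred_haltsWithin.comp (he.pair hn)))).and
      ((Primrec.nat_le.comp primrec_position he).or
        ((Primrec.eq.comp primrec_position (Primrec.succ.comp he)).and h0.not))

theorem primrecPred_related : PrimrecPred fun p : ℕ × ℕ × ℕ => Related p.1 p.2.1 p.2.2 := by
  have hr : ∀ n : ℕ, PrimrecPred fun p : ℕ × ℕ × ℕ => p.1 = n := fun n =>
    Primrec.eq.comp Primrec.fst (Primrec.const n)
  have hx : Primrec fun p : ℕ × ℕ × ℕ => p.2.1 := Primrec.fst.comp Primrec.snd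
  have hy : Primrec fun p : ℕ × ℕ × ℕ => p.2.2 := Primrec.snd.comp Primrec.snd
  have hC := primrec_component.comp hx
  have he := Primrec.fst.comp hC
  have hk := primrec_position.comp hx
  exact ((hr 0).and ((Primrec.eq.comp hC (primrec_component.comp hy)).and
      (Primrec.eq.comp (primrec_position.comp hy) (Primrec.succ.comp hk)))).or <|
    ((hr 1).and (Primrec.eq.comp hk (Primrec.const 0))).or <|
    ((hr 2).and (Primrec.eq.comp hk he)).or <|
    (hr 3).and ((Primrec.eq.comp hk (Primrec.succ.comp he)).and
      (Primrec.eq.comp (Primrec.fst.comp (Primrec.snd.comp hC)) (Primrec.const 1)))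

/-! ### The language and the structures -/

/-- The language with four binary relation symbols. -/
def pathLanguage : FirstOrder.Language.{0, 0} := ⟨fun _ => Empty, fun n => {_r : Fin 4 // n = 2}⟩

instance : pathLanguage.IsRelational := fun _ => inferInstanceAs (IsEmpty Empty)

instance : IsEmpty (pathLanguage.Relations 0) := ⟨fun R => absurd R.2 (by decide)⟩

/-- The numbering of the relation symbols. -/
def pathRep : LanguageRep pathLanguage where
  relCode R := (R.2.1 : ℕ)
  funCode f := nomatch f.2
  relCode_injective := by
    rintro ⟨m, R, rfl⟩ ⟨n, R', rfl⟩ h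
    obtain rfl : R = R' := Fin.ext h
    rfl
  funCode_injective := fun f => nomatch f.2
  disjoint_codes := by
    rw [Set.disjoint_right]
    rintro _ ⟨⟨n, f⟩, rfl⟩
    exact nomatch f
  computable_rel := by
    have h : PrimrecPred fun n : ℕ => n < 4 := Primrec.nat_lt.comp Primrec.id (Primrec.const 4)
    refine h.computablePred.of_eq fun n => ⟨fun hn => ⟨⟨2, ⟨n, hn⟩, rfl⟩, rfl⟩, ?_⟩
    rintro ⟨R, rfl⟩
    exact R.2.1.2
  computable_fun := by
    have h : PrimrecPred fun _ : ℕ => False := ⟨inferInstance, Primrec.const false⟩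
    refine h.computablePred.of_eq fun n => ⟨False.elim, ?_⟩
    rintro ⟨f, rfl⟩
    exact nomatch f.2
  computable_arity := ⟨fun _ => 2, Computable.const 2, fun R => R.2.2.symm, fun f => nomatch f.2⟩

instance : Finite pathLanguage.Symbols := by
  have : Finite (Σ n, pathLanguage.Relations n) :=
    Finite.of_injective (fun R => R.2.1) fun R R' h =>
      pathRep.relCode_injective (congrArg Fin.val h)
  have : IsEmpty (Σ n, pathLanguage.Functions n) := ⟨fun f => nomatch f.2⟩
  exact inferInstanceAs (Finite (_ ⊕ _))

/-- The structure with a given underlying set. -/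
def pathStructure (s : Set ℕ) : NatStructure pathLanguage where
  carrier := s
  str :=
    { funMap := fun f => nomatch f
      RelMap := fun {n} R x => Related (R.1 : ℕ) (x ⟨0, by have := R.2; omega⟩ : s)
        (x ⟨1, by have := R.2; omega⟩ : s) }

theorem relHolds_iff {s : Set ℕ} {n : ℕ} {a : List ℕ} :
    RelHolds pathRep (pathStructure s) n a ↔
      n < 4 ∧ a.length = 2 ∧ a.getI 0 ∈ s ∧ a.getI 1 ∈ s ∧ Related n (a.getI 0) (a.getI 1) := by
  constructor
  · rintro ⟨⟨k, R, rfl⟩, x, rfl, rfl, h⟩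
    exact ⟨R.2, by simp, (x 0).2, (x 1).2, h⟩
  · rintro ⟨hn, ha, h0, h1, h⟩
    obtain ⟨b, c, rfl⟩ := List.length_eq_two.1 ha
    refine ⟨⟨2, ⟨n, hn⟩, rfl⟩, ![⟨b, h0⟩, ⟨c, h1⟩], rfl, by simp, h⟩

theorem relFails_iff {s : Set ℕ} {n : ℕ} {a : List ℕ} :
    RelFails pathRep (pathStructure s) n a ↔
      n < 4 ∧ a.length = 2 ∧ a.getI 0 ∈ s ∧ a.getI 1 ∈ s ∧ ¬ Related n (a.getI 0) (a.getI 1) := by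
  constructor
  · rintro ⟨⟨k, R, rfl⟩, x, rfl, rfl, h⟩
    exact ⟨R.2, by simp, (x 0).2, (x 1).2, h⟩
  · rintro ⟨hn, ha, h0, h1, h⟩
    obtain ⟨b, c, rfl⟩ := List.length_eq_two.1 ha
    refine ⟨⟨2, ⟨n, hn⟩, rfl⟩, ![⟨b, h0⟩, ⟨c, h1⟩], rfl, by simp, h⟩

theorem not_funGraph {s : Set ℕ} {n b : ℕ} {a : List ℕ} :
    ¬ FunGraph pathRep (pathStructure s) n a b := by
  rintro ⟨f, _⟩
  exact nomatch f.2

section Computable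

variable {α : Type} [Primcodable α] {s : α → Set ℕ}

theorem primrecPred_relHolds (hs : PrimrecPred fun p : α × ℕ => p.2 ∈ s p.1) :
    PrimrecPred fun p : α × ℕ × List ℕ => RelHolds pathRep (pathStructure (s p.1)) p.2.1 p.2.2 := by
  have hn : Primrec fun p : α × ℕ × List ℕ => p.2.1 := Primrec.fst.comp Primrec.snd
  have ha : Primrec fun p : α × ℕ × List ℕ => p.2.2 := Primrec.snd.comp Primrec.snd
  have hg : ∀ k, Primrec fun p : α × ℕ × List ℕ => p.2.2.getI k := fun k =>
    Primrec.list_getI.comp ha (Primrec.const k)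
  refine PrimrecPred.of_eq ?_ fun p => relHolds_iff.symm
  exact (Primrec.nat_lt.comp hn (Primrec.const 4)).and <|
    (Primrec.eq.comp (Primrec.list_length.comp ha) (Primrec.const 2)).and <|
    (hs.comp (Primrec.fst.pair (hg 0))).and <| (hs.comp (Primrec.fst.pair (hg 1))).and <|
    primrecPred_related.comp (hn.pair ((hg 0).pair (hg 1)))

theorem primrecPred_relFails (hs : PrimrecPred fun p : α × ℕ => p.2 ∈ s p.1) :
    PrimrecPred fun p : α × ℕ × List ℕ => RelFails pathRep (pathStructure (s p.1)) p.2.1 p.2.2 := by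
  have hn : Primrec fun p : α × ℕ × List ℕ => p.2.1 := Primrec.fst.comp Primrec.snd
  have ha : Primrec fun p : α × ℕ × List ℕ => p.2.2 := Primrec.snd.comp Primrec.snd
  have hg : ∀ k, Primrec fun p : α × ℕ × List ℕ => p.2.2.getI k := fun k =>
    Primrec.list_getI.comp ha (Primrec.const k)
  refine PrimrecPred.of_eq ?_ fun p => relFails_iff.symm
  exact (Primrec.nat_lt.comp hn (Primrec.const 4)).and <|
    (Primrec.eq.comp (Primrec.list_length.comp ha) (Primrec.const 2)).and <|
    (hs.comp (Primrec.fst.pair (hg 0))).and <| (hs.comp (Primrec.fst.pair (hg 1))).and <|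
    (primrecPred_related.comp (hn.pair ((hg 0).pair (hg 1)))).not

end Computable

theorem primrecPred_funGraph {β : Type} [Primcodable β] (s : β → Set ℕ) (n b : β → ℕ)
    (a : β → List ℕ) :
    PrimrecPred fun p : β => FunGraph pathRep (pathStructure (s p)) (n p) (a p) (b p) := by
  have h : PrimrecPred fun _ : β => False := ⟨inferInstance, Primrec.const false⟩
  exact h.of_eq fun p => ⟨False.elim, fun h => not_funGraph h⟩

theorem uniformlyComputable_pathStructure {s : ℕ → Set ℕ}
    (hs : PrimrecPred fun p : ℕ × ℕ => p.2 ∈ s p.1) :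
    UniformlyComputable pathRep fun i => pathStructure (s i) where
  carrier := hs.computablePred
  rel_pos := (primrecPred_relHolds hs).computablePred.to_re
  rel_neg := (primrecPred_relFails hs).computablePred.to_re
  fun_graph := (primrecPred_funGraph _ _ _ _).computablePred.to_re

theorem isComputableStructure_points : IsComputableStructure pathRep (pathStructure points) := by
  have hs : PrimrecPred fun p : Unit × ℕ => p.2 ∈ (fun _ : Unit => points) p.1 :=
    primrecPred_mem_points.comp Primrec.snd
  have hu : Primrec fun p : ℕ × List ℕ => ((), p) := (Primrec.const ()).pair Primrec.id
  exact ⟨primrecPred_mem_points.computablePred,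
    ((primrecPred_relHolds (s := fun _ : Unit => points) hs).comp hu).computablePred.to_re,
    ((primrecPred_relFails (s := fun _ : Unit => points) hs).comp hu).computablePred.to_re,
    (primrecPred_funGraph _ _ _ _).computablePred.to_re⟩

/-! ### Embeddings -/

section Embeddings

variable {s t u : Set ℕ}

/-- An injective function that preserves the relations in both directions is an embedding. -/
def pathEmbedding (f : s → t) (hf : Function.Injective f)
    (hr : ∀ r x y, Related r (f x : ℕ) (f y : ℕ) ↔ Related r x y) :
    (pathStructure s).carrier ↪[pathLanguage] (pathStructure t).carrier where
  toFun := f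
  inj' := hf
  map_fun' := fun f => nomatch f
  map_rel' := fun _ _ => hr _ _ _

theorem related_map_iff (f : (pathStructure s).carrier ↪[pathLanguage] (pathStructure t).carrier)
    {r : ℕ} (hr : r < 4) (x y : (pathStructure s).carrier) :
    Related r (f x : ℕ) (f y : ℕ) ↔ Related r (x : ℕ) (y : ℕ) :=
  f.map_rel (⟨⟨r, hr⟩, rfl⟩ : pathLanguage.Relations 2) ![x, y]

/-- The inclusion of structures. -/
def pathInclusion (h : s ⊆ t) :
    (pathStructure s).carrier ↪[pathLanguage] (pathStructure t).carrier :=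
  pathEmbedding (Set.inclusion h) (Set.inclusion_injective h) fun _ _ _ => Iff.rfl

/-- Restriction of the codomain of an embedding. -/
def pathCodRestrict {B : Type} [pathLanguage.Structure B]
    (f : B ↪[pathLanguage] (pathStructure s).carrier) (h : ∀ b, (f b : ℕ) ∈ t) :
    B ↪[pathLanguage] (pathStructure t).carrier where
  toFun b := ⟨f b, h b⟩
  inj' := fun _ _ hbc => f.injective (Subtype.ext (Subtype.mk.inj hbc))
  map_fun' := fun f => nomatch f
  map_rel' := fun R x => f.map_rel R x

/-- A function on components that induces an embedding. -/
structure IsComponentMap (φ : ℕ × ℕ × ℕ → ℕ × ℕ × ℕ) : Prop where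
  injective : Function.Injective φ
  length : ∀ C, (φ C).1 = C.1
  colour : ∀ C, C.2.1 ≠ 0 → (φ C).2.1 = C.2.1
  isValid : ∀ C, IsValid C → IsValid (φ C)

/-- The self-embedding induced by a function on components. -/
def componentEmbedding {φ : ℕ × ℕ × ℕ → ℕ × ℕ × ℕ} (hφ : IsComponentMap φ) :
    (pathStructure points).carrier ↪[pathLanguage] (pathStructure points).carrier :=
  pathEmbedding
    (fun x => ⟨point (φ (component x)) (position x), by
      obtain ⟨x, hx, hx'⟩ := x
      refine ⟨by simpa using hφ.isValid _ hx, ?_⟩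
      simp only [component_point, position_point, hφ.length]
      exact hx'.imp id fun h => ⟨h.1, by rw [hφ.colour _ h.2]; exact h.2⟩⟩)
    (by
      intro x y h
      have h := congrArg Subtype.val h
      have h1 := congrArg component h
      have h2 := congrArg position h
      simp only [component_point, position_point] at h1 h2
      exact Subtype.ext (point_ext (hφ.injective h1) h2))
    (by
      rintro r ⟨x, hx, hx'⟩ ⟨y, hy⟩
      simp only [Related, component_point, position_point, hφ.length, hφ.injective.eq_iff]
      -- The colour matters only at position `e + 1`, and points there lie in coloured components,
      -- whose colour `φ` preserves.
      have : position x = (component x).1 + 1 →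
          ((φ (component x)).2.1 = 1 ↔ (component x).2.1 = 1) := by
        intro h
        rw [hφ.colour _ (hx'.resolve_left (by omega)).2]
      grind)

/-- An embedding maps a path onto a path of the same length. -/
theorem map_path {C : ℕ × ℕ × ℕ} (hs : ∀ k ≤ C.1, point C k ∈ s)
    (f : (pathStructure s).carrier ↪[pathLanguage] (pathStructure points).carrier) :
    ∃ C', C'.1 = C.1 ∧ IsValid C' ∧
      ∀ k (hk : k ≤ C.1), (f ⟨point C k, hs k hk⟩ : ℕ) = point C' k := by
  let C' := component (f ⟨point C 0, hs 0 (Nat.zero_le _)⟩)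
  -- The mark on the first point fixes position `0`; the successor relation then determines all
  -- later points.
  have key : ∀ k (hk : k ≤ C.1), (f ⟨point C k, hs k hk⟩ : ℕ) = point C' k := by
    intro k
    induction k with
    | zero =>
      intro hk
      have := (related_map_iff f (r := 1) (by omega) ⟨point C 0, hs 0 hk⟩ ⟨point C 0, hs 0 hk⟩).2
        (by simp [related_one])
      rw [related_one] at this
      exact point_ext (by simp [C']) (by simpa using this)
    | succ k ih =>
      intro hk
      have := (related_map_iff f (r := 0) (by omega) ⟨point C k, hs k (by omega)⟩
        ⟨point C (k + 1), hs _ hk⟩).2 (by simp [related_zero])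
      rw [related_zero, ih (by omega)] at this
      exact point_ext (by simpa using this.1.symm) (by simpa using this.2)
  refine ⟨C', ?_, (f ⟨point C 0, hs 0 (Nat.zero_le _)⟩).2.1, key⟩
  have := (related_map_iff f (r := 2) (by omega) ⟨point C C.1, hs _ le_rfl⟩
    ⟨point C C.1, hs _ le_rfl⟩).2 (by simp [related_two])
  rw [related_two, key _ le_rfl] at this
  simpa using this.symm

/-- An embedding maps a coloured path onto a path of the same colour. -/
theorem map_coloured_path {C C' : ℕ × ℕ × ℕ} (hC : IsValid C) (hc : C.2.1 ≠ 0)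
    (hs : point C C.1 ∈ s) (hs' : point C (C.1 + 1) ∈ s)
    (f : (pathStructure s).carrier ↪[pathLanguage] (pathStructure points).carrier)
    (hl : C'.1 = C.1) (hf : (f ⟨_, hs⟩ : ℕ) = point C' C.1) :
    (f ⟨_, hs'⟩ : ℕ) = point C' (C.1 + 1) ∧ C'.2.1 = C.2.1 := by
  have h0 := (related_map_iff f (r := 0) (by omega) ⟨_, hs⟩ ⟨_, hs'⟩).2 (by simp [related_zero])
  rw [related_zero, hf] at h0
  simp only [component_point, position_point] at h0
  have h1 : (f ⟨_, hs'⟩ : ℕ) = point C' (C.1 + 1) :=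
    point_ext (by simpa using h0.1.symm) (by simpa using h0.2)
  refine ⟨h1, ?_⟩
  -- Relation `3` tells whether the colour is `1`. As both colours are `1` or `2`, this forces them
  -- to agree.
  have h3 := related_map_iff f (r := 3) (by omega) ⟨_, hs'⟩ ⟨_, hs'⟩
  rw [related_three, related_three, h1] at h3
  simp only [component_point, position_point, hl, true_and] at h3
  have hp : (f ⟨_, hs'⟩ : ℕ) ∈ points := (f ⟨_, hs'⟩).2
  rw [h1] at hp
  obtain ⟨hv, hp⟩ := hp
  simp only [component_point, position_point, hl] at hp hv
  have hne : C'.2.1 ≠ 0 := (hp.resolve_left (by omega)).2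
  have := (hv.resolve_left hne).1
  have := (hC.resolve_left hc).1
  omega

end Embeddings

/-! ### The canonical age -/

open Classical in
/-- An enumeration of the finite tuples of points. -/
noncomputable def pointTuple (i : ℕ) : List ℕ :=
  (Denumerable.ofNat (List ℕ) i.unpair.1).filter (· ∈ points)

theorem pointTuple_mem {i x : ℕ} (h : x ∈ pointTuple i) : x ∈ points := by
  simpa using (List.mem_filter.1 h).2

theorem pointTuple_pair {a : List ℕ} (ha : ∀ x ∈ a, x ∈ points) (n : ℕ) :
    pointTuple (Nat.pair (Encodable.encode a) n) = a := by
  simpa [pointTuple] using ha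

theorem primrec_pointTuple : Primrec pointTuple := by
  classical
  exact (Primrec.listFilter primrecPred_mem_points).comp
    ((Primrec.ofNat _).comp (Primrec.fst.comp Primrec.unpair))

/-- The canonical computable age. -/
noncomputable def pathAge : ComputableAge pathRep where
  tuple := pointTuple
  struct i := pathStructure {x | x ∈ pointTuple i}
  tuple_mem _ _ h := h
  generates i := by
    rw [eq_top_iff]
    exact fun x _ => Substructure.subset_closure x.2
  computable_tuple := primrec_pointTuple.to_comp
  computable_struct := by
    refine uniformlyComputable_pathStructure ?_
    have h : PrimrecRel fun (l : List ℕ) (x : ℕ) => ∃ a ∈ l, a = x :=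
      PrimrecRel.exists_mem_list Primrec.eq
    exact (h.comp (primrec_pointTuple.comp Primrec.fst) Primrec.snd).of_eq fun p => by simp

theorem isCanonicalAgeOf_points : pathAge.IsCanonicalAgeOf (pathStructure points) where
  tuple_mem _ _ := pointTuple_mem
  infinitely_often a ha :=
    -- `pointTuple` ignores the second coordinate of its index, so each tuple recurs infinitely
    -- often.
    Set.infinite_of_injective_forall_mem (f := Nat.pair (Encodable.encode a))
      (fun m n h => (Nat.pair_eq_pair.1 h).2) (pointTuple_pair ha)
  struct_eq i := by
    refine ⟨pathInclusion fun x => pointTuple_mem, fun x => rfl, ?_⟩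
    refine SetLike.coe_injective ?_
    rw [Substructure.closure_eq_of_isRelational]
    ext x
    constructor
    · rintro ⟨y, rfl⟩
      exact y.2
    · intro hx
      exact ⟨⟨x, hx⟩, rfl⟩

/-- The structure with a given underlying set, as an object. -/
def pathBundled (s : Set ℕ) : CategoryTheory.Bundled.{0} pathLanguage.Structure :=
  ⟨(pathStructure s).carrier, (pathStructure s).str⟩

/-- The age consists of the finite structures that embed into the structure of all points. -/
theorem mem_age_iff {B : CategoryTheory.Bundled.{0} pathLanguage.Structure} :
    B ∈ pathAge.age ↔
      Finite B ∧ Nonempty (B ↪[pathLanguage] (pathStructure points).carrier) := by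
  constructor
  · rintro ⟨i, ⟨e⟩⟩
    have : Finite (pathAge.bundled i) := (List.finite_toSet (pointTuple i)).to_subtype
    refine ⟨Finite.of_equiv _ e.toEquiv.symm, ⟨?_⟩⟩
    exact (pathInclusion (s := {x | x ∈ pointTuple i}) fun x => pointTuple_mem).comp e.toEmbedding
  · rintro ⟨hB, ⟨f⟩⟩
    have hfin : (Set.range fun b => (f b : ℕ)).Finite := Set.finite_range _
    obtain ⟨a, ha⟩ := hfin.exists_finset_coe
    have hmem : ∀ x, x ∈ a.toList ↔ ∃ b, (f b : ℕ) = x := fun x => by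
      rw [Finset.mem_toList, ← Finset.mem_coe, ha, Set.mem_range]
    have ht : pointTuple (Nat.pair (Encodable.encode a.toList) 0) = a.toList :=
      pointTuple_pair (fun x hx => by
        obtain ⟨b, rfl⟩ := (hmem x).1 hx
        exact (f b).2) 0
    let g := pathCodRestrict (t := {x | x ∈ pointTuple (Nat.pair (Encodable.encode a.toList) 0)}) f
      fun b => by
        change _ ∈ pointTuple _
        rw [ht, hmem]
        exact ⟨b, rfl⟩
    refine ⟨Nat.pair (Encodable.encode a.toList) 0,
      ⟨{ Equiv.ofBijective g ⟨g.injective, fun x => ?_⟩ with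
        map_fun' := g.map_fun'
        map_rel' := g.map_rel' }⟩⟩
    obtain ⟨x, hx⟩ := x
    change x ∈ pointTuple _ at hx
    rw [ht, hmem] at hx
    obtain ⟨b, hb⟩ := hx
    exact ⟨b, Subtype.ext hb⟩

theorem pathBundled_mem_age {s : Set ℕ} (hs : s ⊆ points) (hfin : s.Finite) :
    pathBundled s ∈ pathAge.age :=
  mem_age_iff.2 ⟨hfin.to_subtype, ⟨pathInclusion hs⟩⟩

/-- A structure in the age is an amalgamation base if its embeddings into the structure of all
points agree up to self-embeddings. -/
theorem isAmalgamationBase_of_forall {A : CategoryTheory.Bundled.{0} pathLanguage.Structure}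
    (hA : A ∈ pathAge.age) (ι : A ↪[pathLanguage] (pathStructure points).carrier)
    (h : ∀ f : A ↪[pathLanguage] (pathStructure points).carrier,
      ∃ σ : (pathStructure points).carrier ↪[pathLanguage] (pathStructure points).carrier,
        σ.comp f = ι) :
    IsAmalgamationBase pathAge.age A := by
  refine ⟨hA, fun B C f g hB hC => ?_⟩
  obtain ⟨hBfin, ⟨jB⟩⟩ := mem_age_iff.1 hB
  obtain ⟨hCfin, ⟨jC⟩⟩ := mem_age_iff.1 hC
  obtain ⟨σ, hσ⟩ := h (jB.comp f)
  obtain ⟨τ, hτ⟩ := h (jC.comp g)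
  -- After the corrections by `σ` and `τ`, both extensions place `A` by `ι`, so the union of their
  -- images is an amalgam.
  let t : Set ℕ := (Set.range fun b => (σ (jB b) : ℕ)) ∪ Set.range fun c => (τ (jC c) : ℕ)
  have ht : t ⊆ points := by
    rintro _ (⟨b, rfl⟩ | ⟨c, rfl⟩)
    · exact (σ (jB b)).2
    · exact (τ (jC c)).2
  have htf : t.Finite := (Set.finite_range _).union (Set.finite_range _)
  refine ⟨pathBundled t, pathCodRestrict (σ.comp jB) fun b => Or.inl ⟨b, rfl⟩,
    pathCodRestrict (τ.comp jC) fun c => Or.inr ⟨c, rfl⟩, pathBundled_mem_age ht htf, ?_⟩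
  ext a
  refine Subtype.ext ?_
  have h1 := DFunLike.congr_fun hσ a
  have h2 := DFunLike.congr_fun hτ a
  exact (congrArg Subtype.val (h1.trans h2.symm) : (σ (jB (f a))).1 = (τ (jC (g a))).1)

/-! ### Cofinal amalgamation -/

/-- The components that cannot be extended. -/
def IsMaximal (C : ℕ × ℕ × ℕ) : Prop := C.2.1 ≠ 0 ∨ C.1 ∉ zeroJump

/-- The points in the given components. -/
def pointsIn (I : Set (ℕ × ℕ × ℕ)) : Set ℕ := {x | x ∈ points ∧ component x ∈ I}

theorem finite_pointsIn {I : Set (ℕ × ℕ × ℕ)} (hI : I.Finite) : (pointsIn I).Finite := by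
  refine (hI.biUnion fun C _ => (Set.finite_Iic (C.1 + 1)).image (point C)).subset ?_
  rintro x ⟨⟨-, hx⟩, hx'⟩
  refine Set.mem_biUnion hx' ⟨position x, ?_, by simp⟩
  rw [Set.mem_Iic]
  omega

/-- An embedding `f` permits no change of colour on maximal components, so it moves each to one of
the same length and colour. A self-embedding can move them back. -/
theorem isAmalgamationBase_pointsIn {I : Set (ℕ × ℕ × ℕ)} (hI : I.Finite)
    (hv : ∀ C ∈ I, IsValid C) (hm : ∀ C ∈ I, IsMaximal C) :
    IsAmalgamationBase pathAge.age (pathBundled (pointsIn I)) := by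
  refine isAmalgamationBase_of_forall (pathBundled_mem_age (fun x hx => hx.1) (finite_pointsIn hI))
    (pathInclusion fun x hx => hx.1) fun f => ?_
  have hmem : ∀ C ∈ I, ∀ k ≤ C.1, point C k ∈ pointsIn I := fun C hC k hk =>
    ⟨⟨by simpa using hv C hC, Or.inl (by simpa using hk)⟩, by simpa using hC⟩
  have hmem' : ∀ C ∈ I, C.2.1 ≠ 0 → point C (C.1 + 1) ∈ pointsIn I := fun C hC hc =>
    ⟨⟨by simpa using hv C hC, Or.inr (by simpa using hc)⟩, by simpa using hC⟩
  have hex : ∀ C, ∃ C', ∀ hC : C ∈ I, C'.1 = C.1 ∧ C'.2.1 = C.2.1 ∧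
      (∀ k (hk : k ≤ C.1), (f ⟨point C k, hmem C hC k hk⟩ : ℕ) = point C' k) ∧
      ∀ hc : C.2.1 ≠ 0, (f ⟨point C (C.1 + 1), hmem' C hC hc⟩ : ℕ) = point C' (C.1 + 1) := by
    intro C
    by_cases hC : C ∈ I
    · obtain ⟨C', hl, hv', hf⟩ := map_path (hmem C hC) f
      refine ⟨C', fun _ => ⟨hl, ?_, hf, fun hc => ?_⟩⟩
      · by_cases hc : C.2.1 = 0
        -- An uncoloured maximal component has length outside `0'`, and no coloured component has
        -- such a length.
        · by_contra h
          exact (hm C hC).elim (fun h => h hc) fun h' =>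
            h' (hl ▸ hv'.mem_zeroJump (fun h0 => h (h0.trans hc.symm)))
        · exact (map_coloured_path (hv C hC) hc _ (hmem' C hC hc) f hl (hf _ le_rfl)).2
      · exact (map_coloured_path (hv C hC) hc _ (hmem' C hC hc) f hl (hf _ le_rfl)).1
    · exact ⟨C, fun h => absurd h hC⟩
  choose ψ hψ using hex
  have hinj : ∀ C ∈ I, ∀ D ∈ I, ψ C = ψ D → C = D := by
    intro C hC D hD h
    have h1 := (hψ C hC).2.2.1 0 (Nat.zero_le _)
    rw [h, ← (hψ D hD).2.2.1 0 (Nat.zero_le _)] at h1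
    have h2 : point C 0 = point D 0 := Subtype.mk.inj (f.injective (Subtype.ext h1))
    simpa using congrArg component h2
  obtain ⟨N, hN⟩ : ∃ N, ∀ C ∈ I, C.2.2 ≤ N := by
    obtain ⟨N, hN⟩ := (hI.image fun C => C.2.2).bddAbove
    exact ⟨N, fun C hC => hN ⟨C, hC, rfl⟩⟩
  classical
  -- Here `φ` inverts `ψ` on the image of `I` and shifts the copy numbers of all other components
  -- above `N`, clear of `I`.
  let φ : ℕ × ℕ × ℕ → ℕ × ℕ × ℕ := fun D =>
    if h : ∃ C ∈ I, ψ C = D then h.choose else (D.1, D.2.1, D.2.2 + N + 1)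
  have hφ1 : ∀ C ∈ I, φ (ψ C) = C := by
    intro C hC
    have h : ∃ C' ∈ I, ψ C' = ψ C := ⟨C, hC, rfl⟩
    simp only [φ, dif_pos h]
    exact hinj _ h.choose_spec.1 _ hC h.choose_spec.2
  have hφ2 : ∀ D, (¬ ∃ C ∈ I, ψ C = D) → φ D = (D.1, D.2.1, D.2.2 + N + 1) := by
    intro D h
    simp only [φ, dif_neg h]
  have hφ : IsComponentMap φ := by
    refine ⟨fun D D' h => ?_, fun D => ?_, fun D _ => ?_, fun D hD => ?_⟩
    · by_cases h1 : ∃ C ∈ I, ψ C = D <;> by_cases h2 : ∃ C ∈ I, ψ C = D'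
      · obtain ⟨C, hC, rfl⟩ := h1
        obtain ⟨C', hC', rfl⟩ := h2
        rw [hφ1 C hC, hφ1 C' hC'] at h
        rw [h]
      · obtain ⟨C, hC, rfl⟩ := h1
        rw [hφ1 C hC, hφ2 _ h2] at h
        have := hN C hC
        rw [h] at this
        simp only at this
        omega
      · obtain ⟨C, hC, rfl⟩ := h2
        rw [hφ1 C hC, hφ2 _ h1] at h
        have := hN C hC
        rw [← h] at this
        simp only at this
        omega
      · rw [hφ2 _ h1, hφ2 _ h2] at h
        simp only [Prod.mk.injEq] at h
        exact Prod.ext h.1 (Prod.ext h.2.1 (by omega))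
    · by_cases h1 : ∃ C ∈ I, ψ C = D
      · obtain ⟨C, hC, rfl⟩ := h1
        rw [hφ1 C hC, (hψ C hC).1]
      · rw [hφ2 _ h1]
    · by_cases h1 : ∃ C ∈ I, ψ C = D
      · obtain ⟨C, hC, rfl⟩ := h1
        rw [hφ1 C hC, (hψ C hC).2.1]
      · rw [hφ2 _ h1]
    · by_cases h1 : ∃ C ∈ I, ψ C = D
      · obtain ⟨C, hC, rfl⟩ := h1
        rw [hφ1 C hC]
        exact hv C hC
      · rw [hφ2 _ h1]
        exact IsValid.mono (m := D.2.2) (by omega) hD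
  refine ⟨componentEmbedding hφ, ?_⟩
  ext ⟨x, hx⟩
  change point (φ (component (f ⟨x, hx⟩))) (position (f ⟨x, hx⟩)) = x
  have hC : component x ∈ I := hx.2
  have hfx : (f ⟨x, hx⟩ : ℕ) = point (ψ (component x)) (position x) := by
    rcases hx.1.2 with hp | ⟨hp, hc⟩
    · have := (hψ _ hC).2.2.1 _ hp
      simpa only [point_component_position] using this
    · have := (hψ _ hC).2.2.2 hc
      simpa only [← hp, point_component_position] using this
  rw [hfx, component_point, position_point, hφ1 _ hC, point_component_position]

/-- The structure of all points embeds into the part consisting of maximal components. -/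
theorem exists_isComponentMap_isMaximal :
    ∃ φ, IsComponentMap φ ∧ ∀ C, IsMaximal (φ C) := by
  classical
  have hex : ∀ e, ∃ n, e ∈ zeroJump → HaltsWithin e n := fun e => by
    by_cases he : e ∈ zeroJump
    · obtain ⟨n, hn⟩ := mem_zeroJump_iff.1 he
      exact ⟨n, fun _ => hn⟩
    · exact ⟨0, fun h => absurd h he⟩
  choose h hh using hex
  -- Newly coloured components receive odd copy numbers that are at least a halting time; all others
  -- receive even ones. Parity gives injectivity.
  refine ⟨fun C => if C.2.1 = 0 ∧ C.1 ∈ zeroJump then (C.1, 1, 2 * (C.2.2 + h C.1) + 1)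
    else (C.1, C.2.1, 2 * C.2.2), ⟨?_, ?_, ?_, ?_⟩, ?_⟩
  · rintro ⟨e, c, n⟩ ⟨e', c', n'⟩ heq
    simp only at heq
    split_ifs at heq with h1 h2 h2 <;> simp only [Prod.mk.injEq] at heq ⊢ <;>
      obtain ⟨rfl, h3, h4⟩ := heq <;> refine ⟨rfl, ?_, ?_⟩ <;> omega
  · intro C
    split_ifs <;> rfl
  · intro C hC
    simp [hC]
  · rintro ⟨e, c, n⟩ hC
    split_ifs with h1
    · exact Or.inr ⟨one_le_two, (hh e h1.2).mono (by dsimp only; omega)⟩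
    · exact IsValid.mono (by dsimp only; omega) hC
  · intro C
    beta_reduce
    split_ifs with h1
    · exact Or.inl one_ne_zero
    · rcases not_and_or.1 h1 with h1 | h1
      · exact Or.inl h1
      · exact Or.inr h1

/-- First move the structure into maximal components, then fill up the finitely many components that
it meets. -/
theorem cofinalAmalgamation_pathAge : CofinalAmalgamation pathAge.age := by
  intro A hA
  obtain ⟨hfin, ⟨j⟩⟩ := mem_age_iff.1 hA
  obtain ⟨φ, hφ, hmax⟩ := exists_isComponentMap_isMaximal
  let ρ := (componentEmbedding hφ).comp j
  let I : Set (ℕ × ℕ × ℕ) := Set.range fun a => component (ρ a)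
  refine ⟨pathBundled (pointsIn I), ⟨pathCodRestrict ρ fun a => ⟨(ρ a).2, a, rfl⟩⟩,
    isAmalgamationBase_pointsIn (Set.finite_range _) ?_ ?_⟩
  · rintro _ ⟨a, rfl⟩
    exact (ρ a).2.1
  · rintro _ ⟨a, rfl⟩
    change IsMaximal (component (point (φ (component (j a))) (position (j a))))
    rw [component_point]
    exact hmax _

/-! ### Structures that are not amalgamation bases -/

/-- If `e` halts, then an uncoloured component of length `e` can be turned into a coloured one. -/
theorem exists_isComponentMap_colour {e n c h : ℕ} (hc : c ≤ 2)
    (hh : HaltsWithin e h) :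
    ∃ φ, IsComponentMap φ ∧ φ (e, 0, n) = (e, c, h) := by
  classical
  -- The copies of length `e` and colour `c` move past `h`, leaving the place `(e, c, h)` free.
  refine ⟨fun C => if C = (e, 0, n) then (e, c, h) else
    if C.1 = e ∧ C.2.1 = c then (e, c, C.2.2 + h + 1) else C, ⟨?_, ?_, ?_, ?_⟩, by simp⟩
  · rintro ⟨e1, c1, n1⟩ ⟨e2, c2, n2⟩ heq
    simp only [Prod.mk.injEq] at heq ⊢
    split_ifs at heq <;> simp only [Prod.mk.injEq] at heq <;> omega
  · intro C
    split_ifs with h1 h2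
    · rw [h1]
    · exact h2.1.symm
    · rfl
  · intro C hC
    split_ifs with h1 h2
    · simp [h1] at hC
    · exact h2.2.symm
    · rfl
  · intro C hC
    split_ifs with h1 h2
    · exact Or.inr ⟨hc, hh⟩
    · exact Or.inr ⟨hc, hh.mono (by dsimp only; omega)⟩
    · exact hC

/-- Recolouring the component `(e, 0, n)` in the two possible ways and adding the coloured point
gives two extensions of `s`. In an amalgam, the two coloured points would both succeed the same
endpoint. -/
theorem not_isAmalgamationBase {s : Set ℕ} (hs : s ⊆ points) (hfin : s.Finite) {e n : ℕ}
    (he : e ∈ zeroJump) (hmem : point (e, 0, n) e ∈ s) :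
    ¬ IsAmalgamationBase pathAge.age (pathBundled s) := by
  obtain ⟨h, hh⟩ := mem_zeroJump_iff.1 he
  have hext : ∀ c, c ≠ 0 → c ≤ 2 → ∃ (t : Set ℕ) (ht : point (e, c, h) (e + 1) ∈ t)
      (f : (pathStructure s).carrier ↪[pathLanguage] (pathStructure t).carrier),
      pathBundled t ∈ pathAge.age ∧ (f ⟨_, hmem⟩ : ℕ) = point (e, c, h) e := by
    intro c hc hc'
    obtain ⟨φ, hφ, hφe⟩ := exists_isComponentMap_colour (n := n) hc' hh
    let f := (componentEmbedding hφ).comp (pathInclusion hs)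
    have hf : ∀ a, (f a : ℕ) ∈ points := fun a => (f a).2
    have hsf : Finite (pathStructure s).carrier := hfin.to_subtype
    refine ⟨insert (point (e, c, h) (e + 1)) (Set.range fun a => (f a : ℕ)),
      Set.mem_insert _ _, pathCodRestrict f fun a => Or.inr ⟨a, rfl⟩,
      pathBundled_mem_age ?_ ((Set.finite_range _).insert _), ?_⟩
    · rw [Set.insert_subset_iff, Set.range_subset_iff]
      refine ⟨⟨?_, Or.inr ?_⟩, hf⟩
      · rw [component_point]
        exact Or.inr ⟨hc', hh⟩
      · simpa using hc
    · change point (φ (component (point (e, 0, n) e))) (position (point (e, 0, n) e)) = _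
      rw [component_point, position_point, hφe]
  obtain ⟨t₁, ht₁, f₁, hage₁, hf₁⟩ := hext 1 (by omega) (by omega)
  obtain ⟨t₂, ht₂, f₂, hage₂, hf₂⟩ := hext 2 (by omega) (by omega)
  intro hbase
  obtain ⟨D, g₁, g₂, hD, hg⟩ := hbase.2 (pathBundled t₁) (pathBundled t₂) f₁ f₂ hage₁ hage₂
  obtain ⟨-, ⟨j⟩⟩ := mem_age_iff.1 hD
  let u : (pathStructure t₁).carrier ↪[pathLanguage] (pathStructure points).carrier := j.comp g₁
  let v : (pathStructure t₂).carrier ↪[pathLanguage] (pathStructure points).carrier := j.comp g₂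
  have huv : u (f₁ ⟨_, hmem⟩) = v (f₂ ⟨_, hmem⟩) :=
    congrArg j (DFunLike.congr_fun hg (⟨_, hmem⟩ : (pathStructure s).carrier))
  have h1 := (related_map_iff u (r := 0) (by omega) (f₁ ⟨_, hmem⟩) ⟨_, ht₁⟩).2
    (by rw [hf₁, related_zero]; simp)
  have h2 := (related_map_iff v (r := 0) (by omega) (f₂ ⟨_, hmem⟩) ⟨_, ht₂⟩).2
    (by rw [hf₂, related_zero]; simp)
  rw [huv, related_zero] at h1
  rw [related_zero] at h2
  -- A point has at most one successor, so the points of colours `1` and `2` are identified;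
  -- relation `3` distinguishes them.
  have hX : (u ⟨_, ht₁⟩ : ℕ) = v ⟨_, ht₂⟩ :=
    point_ext (h1.1.symm.trans h2.1) (h1.2.trans h2.2.symm)
  have h3 := (related_map_iff u (r := 3) (by omega) ⟨_, ht₁⟩ ⟨_, ht₁⟩).2
    (by simp [related_three])
  rw [hX, related_map_iff v (r := 3) (by omega), related_three] at h3
  simp at h3

/-! ### Deciding the halting problem -/

/-- The points of the first uncoloured component of length `e`. -/
def pathTuple (e : ℕ) : List ℕ := (List.range (e + 1)).map (point (e, 0, 0))

theorem mem_pathTuple {e k : ℕ} (hk : k ≤ e) : point (e, 0, 0) k ∈ pathTuple e :=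
  List.mem_map_of_mem (List.mem_range.2 (by omega))

theorem primrec_pathTuple : Primrec pathTuple := by
  refine Primrec.list_map (Primrec.list_range.comp Primrec.succ)
    (g := fun e k => point (e, 0, 0) k) ?_
  exact primrec_point.comp (Primrec.fst.pair (Primrec.const (0, 0))) Primrec.snd

theorem exists_pointTuple_eq_pathTuple (e : ℕ) : ∃ i, pointTuple i = pathTuple e := by
  refine ⟨_, pointTuple_pair (fun x hx => ?_) 0⟩
  obtain ⟨k, hk, rfl⟩ := List.mem_map.1 hx
  rw [List.mem_range] at hk
  exact ⟨by simp [IsValid], by simp; omega⟩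

theorem headI_pmap {p : ℕ → Prop} {f : ∀ x, p x → ℕ} {l l' : List ℕ} {a : ℕ}
    (H : ∀ x ∈ l, p x) (hl : l = a :: l') : (l.pmap f H).headI = f a (H a (by simp [hl])) := by
  subst hl
  rfl

/-- The colour of the image of a path in an amalgamation base shows whether its length
is in `0'`. -/
theorem colour_ne_zero_iff {F : AgeMap} (hF : pathAge.IsEmbedding F)
    (hbase : IsAmalgamationBase pathAge.age (pathAge.bundled F.cod)) {e : ℕ}
    (he : pointTuple F.dom = pathTuple e) :
    (component F.range.headI).2.1 ≠ 0 ↔ e ∈ zeroJump := by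
  obtain ⟨f, hf⟩ := hF
  let s : Set ℕ := {x | x ∈ pointTuple F.dom}
  let t : Set ℕ := {x | x ∈ pointTuple F.cod}
  have hs : ∀ k ≤ e, point (e, 0, 0) k ∈ s := fun k hk => by
    change _ ∈ pointTuple F.dom
    rw [he]
    exact mem_pathTuple hk
  have ht : t ⊆ points := fun x => pointTuple_mem
  obtain ⟨⟨e', c, n⟩, hl, hv, hfk⟩ := map_path (s := s) (C := (e, 0, 0)) hs
    ((pathInclusion ht).comp f)
  obtain rfl : e' = e := hl
  have hhead : F.range.headI = point (e', c, n) 0 := by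
    rw [← hf]
    refine (headI_pmap (l' := (List.range e').map fun k => point (e', 0, 0) (k + 1))
      (a := point (e', 0, 0) 0) _ ?_).trans (hfk 0 (Nat.zero_le _))
    change pointTuple F.dom = _
    rw [he, pathTuple, List.range_succ_eq_map]
    simp [Function.comp_def]
  rw [hhead, component_point]
  -- If the image were uncoloured although `e'` lies in `0'`, its endpoint would prevent the
  -- codomain from being an amalgamation base.
  refine ⟨hv.mem_zeroJump, fun hz hc => ?_⟩
  obtain rfl : c = 0 := hc
  have hmem : point (e', 0, n) e' ∈ t := by
    rw [← hfk e' le_rfl]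
    exact (f ⟨_, hs e' le_rfl⟩).2
  exact not_isAmalgamationBase ht (List.finite_toSet _) hz hmem hbase

theorem zeroJump_setTuringLE {S : Set ℕ} (h : pathAge.HasComputableCoAP S) :
    SetTuringLE zeroJump S := by
  obtain ⟨W, Φ, hW, hWS, -⟩ := h
  -- The search looks for any distinguished extension whose domain tuple is the path of length `e`;
  -- the answer is the colour at the first entry of its range.
  refine setTuringLE_of_search hWS (r := fun e F => decide (pointTuple F.1 = pathTuple e))
    (q := fun F => decide ((component F.2.2.headI).2.1 ≠ 0)) ?_ ?_ ?_ ?_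
  · exact (Primrec.eq.decide.comp (primrec_pointTuple.comp (Primrec.fst.comp Primrec.snd))
      (primrec_pathTuple.comp Primrec.fst)).to_comp
  · have h1 : Primrec fun F : AgeMap => (component F.2.2.headI).2.1 :=
      Primrec.fst.comp (Primrec.snd.comp (primrec_component.comp
        (Primrec.list_headI.comp (Primrec.snd.comp Primrec.snd))))
    exact (Primrec.eq.comp h1 (Primrec.const 0)).not.decide.to_comp
  · intro e
    obtain ⟨i, hi⟩ := exists_pointTuple_eq_pathTuple e
    obtain ⟨F, hF, rfl⟩ := hW.distinguished.exists_dom i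
    exact ⟨F, hF, by simpa using hi⟩
  · intro e F hF he
    rw [decide_eq_true_iff] at he ⊢
    exact colour_ne_zero_iff (hW.distinguished.embedding F hF) (hW.base F hF) he

end CompAge

theorem mainTheorem5 :
    ∃ (L : FirstOrder.Language.{0, 0}) (ρ : CompAge.LanguageRep L),
      Finite L.Symbols ∧ L.IsRelational ∧ IsEmpty (L.Relations 0) ∧
      ∃ M : CompAge.NatStructure L, CompAge.IsComputableStructure ρ M ∧
      ∃ K : CompAge.ComputableAge ρ, K.IsCanonicalAgeOf M ∧
        CompAge.CofinalAmalgamation K.age ∧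
        ∀ S : Set ℕ, K.HasComputableCoAP S → CompAge.SetTuringLE CompAge.zeroJump S :=
  ⟨CompAge.pathLanguage, CompAge.pathRep, inferInstance, inferInstance, inferInstance,
    CompAge.pathStructure CompAge.points, CompAge.isComputableStructure_points,
    CompAge.pathAge, CompAge.isCanonicalAgeOf_points, CompAge.cofinalAmalgamation_pathAge,
    fun _ => CompAge.zeroJump_setTuringLE⟩
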